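/- Let $S$ be a finite set of states and let $\Delta$ assign to every $s\in S$ a probability distribution $\Delta(s)$ on $S$ (a finite Markov chain). Let $\nu:S\to 2^{AP}$ be a valuation, where $AP$ is a set of atomic propositions. For $s\in S$ let $\mathbb P_s$ and $\mathbb E_s$ be the probability measure and the expectation on runs $\omega=s_0s_1\cdots$ of the chain started in $s$, with the $\sigma$-algebra generated by cylinders, and let $\omega(i)=s_is_{i+1}\cdots$. For a sequence $x_0,x_1,\ldots$ of numbers put $\mathrm{freq}(x_0x_1\ldots)=\liminf_{n\to\infty}\frac1n\sum_{j<n}x_j$. LTL formulae are given by $\varphi::=\alpha\mid\neg\varphi\mid\varphi\vee\varphi\mid\mathbf X\varphi\mid\varphi\,\mathbf U\,\varphi$ with $\alpha\in AP$. Their semantics on runs is the usual one: $\omega\models\alpha$ iff $\alpha\in\nu(s_0)$; negation and disjunction are Boolean; $\omega\models\mathbf X\varphi$ iff $\omega(1)\models\varphi$; $\omega\models\varphi_1\mathbf U\varphi_2$ iff there is $k\ge 0$ with $\omega(k)\models\varphi_2$ and $\omega(\ell)\models\varphi_1$ for all $\ell<k$. For a real number $p$ put $\omega\models\mathbf G^p\varphi$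 iff $\mathrm{freq}(\mathbf 1_{\varphi,0}\mathbf 1_{\varphi,1}\ldots)\ge p$, where $\mathbf 1_{\varphi,i}$ is $1$ if $\omega(i)\models\varphi$ and $0$ otherwise. A bottom strongly connected component (bscc) is a non-empty set $B\subseteq S$ such that for every $s\in B$ the set of states reachable from $s$ is exactly $B$. The steady-state frequency of a state $t$ in a bscc is $x_t=\mathbb E_t[\mathrm{freq}(\mathbf 1_{t,0}\mathbf 1_{t,1}\ldots)]$, where $\mathbf 1_{t,i}(\omega)$ is $1$ if the $i$-th state of $\omega$ is $t$ and $0$ otherwise. Write $\mathbb P_t(\varphi)=\mathbb P_t(\{\omega\mid\omega\models\varphi\})$. Then for every initial state $s_{in}\in S$, every LTL formula $\varphi$, every real number $p$ and every bscc $B$, for $\mathbb P_{s_{in}}$-almost every run $\omega$: if $\omega$ enters $B$, then $$\omega\models\mathbf G^p\varphi\quad\Longleftrightarrow\quad\sum_{t\in B}x_t\cdot\mathbb P_t(\varphi)\ge p .$$ -/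

import Mathlib

namespace FreqLTL

/-- Syntax of frequency LTL over a set `AP` of atomic propositions. -/
inductive Formula (AP : Type*) : Type _
  | atom (a : AP) : Formula AP
  | neg (φ : Formula AP) : Formula AP
  | or (φ ψ : Formula AP) : Formula AP
  | next (φ : Formula AP) : Formula AP
  | untl (φ ψ : Formula AP) : Formula AP
  | freqG (p : ℝ) (φ : Formula AP) : Formula AP

/-- LTL formulae: the frequency LTL formulae in which no frequency operator occurs. -/
def Formula.IsLTL {AP : Type*} : Formula AP → Prop
  | .atom _ => True
  | .neg φ => φ.IsLTL
  | .or φ ψ => φ.IsLTL ∧ ψ.IsLTL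
  | .next φ => φ.IsLTL
  | .untl φ ψ => φ.IsLTL ∧ ψ.IsLTL
  | .freqG _ _ => False

/-- The limit inferior of the running averages of a sequence. It is only applied to sequences
with values in `{0, 1}`, whose running averages are bounded. -/
noncomputable def freq (x : ℕ → ℝ) : ℝ :=
  Filter.liminf (fun n : ℕ => (1 / (n : ℝ)) * ∑ j ∈ Finset.range n, x j) Filter.atTop

/-- The suffix of `ω` starting at position `i`. -/
def suffix {S : Type*} (ω : ℕ → S) (i : ℕ) : ℕ → S := fun n => ω (i + n)

/-- Satisfaction of a formula on a sequence of states, for a valuation `ν`. -/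
def Sat {S AP : Type*} (ν : S → Set AP) : Formula AP → (ℕ → S) → Prop
  | .atom a, ω => a ∈ ν (ω 0)
  | .neg φ, ω => ¬ Sat ν φ ω
  | .or φ ψ, ω => Sat ν φ ω ∨ Sat ν ψ ω
  | .next φ, ω => Sat ν φ (suffix ω 1)
  | .untl φ ψ, ω => ∃ k, Sat ν ψ (suffix ω k) ∧ ∀ l < k, Sat ν φ (suffix ω l)
  | .freqG p φ, ω => p ≤ freq (Set.indicator {i : ℕ | Sat ν φ (suffix ω i)} 1)

section MarkovChain

variable {S : Type*} [MeasurableSpace S] [DiscreteMeasurableSpace S]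

/-- The one-step kernel of the Markov chain with transition function `Δ`. -/
noncomputable def stepKernel (Δ : S → PMF S) : ProbabilityTheory.Kernel S S where
  toFun s := (Δ s).toMeasure
  measurable' := Measurable.of_discrete

instance isMarkovKernel_stepKernel (Δ : S → PMF S) : ProbabilityTheory.IsMarkovKernel (stepKernel Δ) :=
  ⟨fun s => PMF.toMeasure.isProbabilityMeasure (Δ s)⟩

/-- The law of the runs of the Markov chain `Δ` started in `s`, on the space `ℕ → S` with the
σ-algebra generated by cylinders: the state at time `0` is `s`, and given a history of length
`n + 1` the next state is distributed as `Δ` of its last state. -/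
noncomputable def runMeasure (Δ : S → PMF S) (s : S) : MeasureTheory.Measure (ℕ → S) :=
  ProbabilityTheory.Kernel.trajMeasure (X := fun _ => S) (MeasureTheory.Measure.dirac s)
    (fun n => (stepKernel Δ).comap
      (fun h : (i : Finset.Iic n) → S => h ⟨n, Finset.mem_Iic.2 le_rfl⟩)
      (measurable_pi_apply _))

/-- The probability that a run started in `s` satisfies `φ`. -/
noncomputable def satProb {AP : Type*} (Δ : S → PMF S) (ν : S → Set AP) (s : S)
    (φ : Formula AP) : ℝ :=
  (runMeasure Δ s).real {ω | Sat ν φ ω}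

/-- The steady-state frequency of `s`: the expected frequency of visits to `s` on a run started
in `s`. -/
noncomputable def steadyFreq (Δ : S → PMF S) (s : S) : ℝ :=
  ∫ ω, freq (Set.indicator {i : ℕ | ω i = s} 1) ∂(runMeasure Δ s)

end MarkovChain

/-- `t` is reachable from `s` by a finite path with positive transition probabilities. -/
def Reachable {S : Type*} (Δ : S → PMF S) : S → S → Prop :=
  Relation.ReflTransGen (fun s t => 0 < Δ s t)

/-- `B` is a bottom strongly connected component: from each of its states, the set of reachable
states is exactly `B`. -/
def IsBSCC {S : Type*} (Δ : S → PMF S) (B : Finset S) : Prop :=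
  B.Nonempty ∧ ∀ s ∈ B, {t | Reachable Δ s t} = (B : Set S)

end FreqLTL

/-! This is the ergodic theorem for the shift on runs. A bscc `B` carries a stationary distribution
`w`, and starting the chain from `w` makes the law of runs shift-invariant
(`IsBSCC.measurePreserving_mixture`). Shift-invariant events have probability 0 from all states of
`B` or 1 from all of them (`IsBSCC.zero_one`). Combined with the maximal ergodic theorem, this makes
the time averages of a bounded measurable `f` converge almost surely to the sum of `w t * 𝔼_t f`
over `B`, from every state of `B`. The Markov property extends this to every run that enters `B`.

Taking `f` to be the indicator of "the run starts in `t`" identifies `w t` with the steady-state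
frequency (`IsBSCC.steadyFreq_eq`). Taking it to be the indicator of `φ` shows that the frequency of
`φ` is almost surely the constant in the theorem, so satisfying the frequency formula means that
this constant is at least `p`. -/

open MeasureTheory ProbabilityTheory Filter Topology
open scoped ENNReal NNReal

namespace FreqLTL

/-! ### The maximal ergodic theorem. -/

section MaximalErgodic

variable {α : Type*}

/-- The maximum of the first `N + 1` Birkhoff sums (the empty one included), defined recursively. -/
noncomputable def birkhoffMax (T : α → α) (g : α → ℝ) : ℕ → α → ℝ
  | 0, _ => 0
  | N + 1, x => max 0 (g x + birkhoffMax T g N (T x))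

lemma birkhoffMax_nonneg (T : α → α) (g : α → ℝ) (N : ℕ) (x : α) : 0 ≤ birkhoffMax T g N x := by
  cases N with
  | zero => exact le_rfl
  | succ N => exact le_max_left _ _

lemma birkhoffMax_le_succ (T : α → α) (g : α → ℝ) (N : ℕ) (x : α) :
    birkhoffMax T g N x ≤ birkhoffMax T g (N + 1) x := by
  induction N generalizing x with
  | zero => exact le_max_left _ _
  | succ N ih =>
    have := ih (T x)
    simp only [birkhoffMax] at this ⊢
    gcongr

lemma monotone_birkhoffMax (T : α → α) (g : α → ℝ) (x : α) :
    Monotone fun N => birkhoffMax T g N x :=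
  monotone_nat_of_le_succ fun N => birkhoffMax_le_succ T g N x

lemma birkhoffSum_le_birkhoffMax (T : α → α) (g : α → ℝ) (N : ℕ) (x : α) :
    birkhoffSum T g N x ≤ birkhoffMax T g N x := by
  induction N generalizing x with
  | zero => simp [birkhoffMax]
  | succ N ih =>
    rw [birkhoffSum_succ']
    exact le_trans (by gcongr; exact ih _) (le_max_right _ _)

/-- Where the maximum is positive, it equals `g x` plus the previous maximum at `T x`, which is at
most the current one there. Elsewhere it vanishes, while its value at `T x` is nonnegative. -/
lemma birkhoffMax_sub_le (T : α → α) (g : α → ℝ) (N : ℕ) (x : α) :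
    birkhoffMax T g N x - birkhoffMax T g N (T x) ≤
      Set.indicator {y | 0 < birkhoffMax T g N y} g x := by
  by_cases hx : 0 < birkhoffMax T g N x
  · rw [Set.indicator_of_mem (by exact hx)]
    cases N with
    | zero => exact absurd hx (lt_irrefl _)
    | succ N =>
      have h1 := birkhoffMax_le_succ T g N (T x)
      have h2 : birkhoffMax T g (N + 1) x = g x + birkhoffMax T g N (T x) := by
        simp only [birkhoffMax] at hx ⊢
        exact max_eq_right (le_of_lt (by simpa using hx))
      linarith
  · rw [Set.indicator_of_notMem (by exact hx)]
    have := birkhoffMax_nonneg T g N (T x)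
    linarith [not_lt.1 hx]

variable [MeasurableSpace α] {μ : Measure α} {T : α → α} {g : α → ℝ}

lemma measurable_birkhoffMax (hT : Measurable T) (hg : Measurable g) (N : ℕ) :
    Measurable (birkhoffMax T g N) := by
  induction N with
  | zero => exact measurable_const
  | succ N ih => exact measurable_const.max (hg.add (ih.comp hT))

lemma integrable_birkhoffMax (hT : MeasurePreserving T μ μ) (hg : Integrable g μ) (N : ℕ) :
    Integrable (birkhoffMax T g N) μ := by
  induction N with
  | zero => exact integrable_zero _ _ _
  | succ N ih => exact (integrable_zero _ _ _).sup (hg.add (hT.integrable_comp_of_integrable ih))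

/-- Maximal ergodic theorem: if almost every point has a positive Birkhoff sum of `g`, then the
integral of `g` is nonnegative. -/
theorem integral_nonneg_of_ae_exists_birkhoffSum_pos (hT : MeasurePreserving T μ μ)
    (hgm : Measurable g) (hg : Integrable g μ) (h : ∀ᵐ x ∂μ, ∃ n, 0 < birkhoffSum T g n x) :
    0 ≤ ∫ x, g x ∂μ := by
  have hms : ∀ N, MeasurableSet {y | 0 < birkhoffMax T g N y} := fun N =>
    measurableSet_lt measurable_const (measurable_birkhoffMax hT.measurable hgm N)
  have hN : ∀ N, 0 ≤ ∫ x, Set.indicator {y | 0 < birkhoffMax T g N y} g x ∂μ := by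
    intro N
    have hi := integrable_birkhoffMax hT hg N
    have hiT := hT.integrable_comp_of_integrable hi
    -- By invariance of `μ` the coboundary integrates to zero.
    have h0 : ∫ x, (birkhoffMax T g N x - birkhoffMax T g N (T x)) ∂μ = 0 := by
      rw [integral_sub hi (by exact hiT)]
      have := integral_map (μ := μ) (φ := T) (f := birkhoffMax T g N) hT.aemeasurable
        (by rw [hT.map_eq]; exact hi.aestronglyMeasurable)
      rw [hT.map_eq] at this
      rw [this, sub_self]
    refine h0.symm.le.trans ?_
    exact integral_mono (hi.sub hiT) (hg.indicator (hms N)) (birkhoffMax_sub_le T g N)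
  -- The sets where the maximum is positive increase to almost the whole space; `|g|` dominates.
  refine ge_of_tendsto' (tendsto_integral_of_dominated_convergence (fun x => |g x|)
    (fun N => (hg.indicator (hms N)).aestronglyMeasurable) hg.abs (fun N => ?_) ?_) hN
  · refine ae_of_all _ fun x => ?_
    rw [Real.norm_eq_abs]
    by_cases hx : x ∈ {y | 0 < birkhoffMax T g N y}
    · rw [Set.indicator_of_mem hx]
    · rw [Set.indicator_of_notMem hx, abs_zero]; positivity
  · filter_upwards [h] with x hx
    obtain ⟨n, hn⟩ := hx
    refine tendsto_const_nhds.congr' ?_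
    filter_upwards [eventually_ge_atTop n] with N hnN
    rw [Set.indicator_of_mem]
    exact lt_of_lt_of_le (hn.trans_le (birkhoffSum_le_birkhoffMax T g n x))
      (monotone_birkhoffMax T g x hnN)

end MaximalErgodic

/-! ### Cylinders and shifts of runs. -/

section Path

variable {S : Type*}

/-- The set of runs that agree with `x` up to time `n`. -/
def cyl (x : ℕ → S) (n : ℕ) : Set (ℕ → S) := {ω | ∀ i ≤ n, ω i = x i}

/-- The sequence that follows `x` and then stays in its last state. -/
def stopped {n : ℕ} (x : Fin (n + 1) → S) : ℕ → S :=
  fun i => x ⟨min i n, Nat.lt_succ_of_le (min_le_right _ _)⟩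

lemma mem_cyl_stopped (ω : ℕ → S) (n : ℕ) : ω ∈ cyl (stopped fun i : Fin (n + 1) => ω i) n := by
  intro i hi
  simp [stopped, hi]

lemma suffix_zero (ω : ℕ → S) : suffix ω 0 = ω := by
  funext n; simp [suffix]

lemma suffix_suffix (ω : ℕ → S) (i j : ℕ) : suffix (suffix ω i) j = suffix ω (i + j) := by
  funext n; simp [suffix, add_assoc]

lemma iterate_suffix_one (ω : ℕ → S) (n : ℕ) : (fun ω => suffix ω 1)^[n] ω = suffix ω n := by
  induction n generalizing ω with
  | zero => exact (suffix_zero ω).symm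
  | succ n ih => rw [Function.iterate_succ_apply, ih, suffix_suffix, add_comm]

/-- The two prefixes overlap at time `n`, so they glue to one prefix exactly because `y 0 = x n`. -/
lemma cyl_inter_suffix (x y : ℕ → S) (n m : ℕ) (h : y 0 = x n) :
    cyl x n ∩ (fun ω => suffix ω n) ⁻¹' cyl y m =
      cyl (fun i => if i ≤ n then x i else y (i - n)) (n + m) := by
  ext ω
  simp only [cyl, suffix, Set.mem_inter_iff, Set.mem_ofPred_eq, Set.mem_preimage]
  constructor
  · rintro ⟨h1, h2⟩ i hi
    split_ifs with hin
    · exact h1 i hin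
    · have := h2 (i - n) (by omega)
      rwa [show n + (i - n) = i by omega] at this
  · intro H
    refine ⟨fun i hi => by simpa [hi] using H i (by omega), fun i hi => ?_⟩
    have := H (n + i) (by omega)
    rcases Nat.eq_zero_or_pos i with rfl | hi0
    · simpa [h] using this
    · rw [if_neg (by omega)] at this
      simpa using this

lemma isPiSystem_cyl : IsPiSystem {A : Set (ℕ → S) | ∃ x n, A = cyl x n} := by
  rintro _ ⟨x, n, rfl⟩ _ ⟨y, m, rfl⟩ ⟨ω, h1, h2⟩
  refine ⟨ω, max n m, ?_⟩
  ext η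
  constructor
  · rintro ⟨h3, h4⟩ i hi
    rcases le_max_iff.1 hi with hi | hi
    · rw [h3 i hi, h1 i hi]
    · rw [h4 i hi, h2 i hi]
  · intro h
    exact ⟨fun i hi => by rw [h i (by omega), h1 i hi], fun i hi => by rw [h i (by omega), h2 i hi]⟩

variable [MeasurableSpace S]

lemma measurable_suffix (n : ℕ) : Measurable fun ω : ℕ → S => suffix ω n :=
  measurable_pi_lambda _ fun i => measurable_pi_apply (n + i)

variable [DiscreteMeasurableSpace S]

lemma measurableSet_apply_eq (n : ℕ) (s : S) : MeasurableSet {ω : ℕ → S | ω n = s} :=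
  show MeasurableSet ((fun ω : ℕ → S => ω n) ⁻¹' {s}) from
    measurable_pi_apply n (measurableSet_singleton s)

lemma measurableSet_cyl (x : ℕ → S) (n : ℕ) : MeasurableSet (cyl x n) := by
  have : cyl x n = ⋂ i, ⋂ (_ : i ≤ n), (fun ω : ℕ → S => ω i) ⁻¹' {x i} := by
    ext ω; simp [cyl]
  rw [this]
  exact MeasurableSet.iInter fun i => MeasurableSet.iInter fun _ =>
    measurable_pi_apply i (MeasurableSet.of_discrete)

/-- Since `S` is finite, an event about coordinate `i` is a finite union of cylinders, one per
history of length `i + 1`. -/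
lemma generateFrom_cyl [Finite S] :
    (MeasurableSpace.pi : MeasurableSpace (ℕ → S)) =
      MeasurableSpace.generateFrom {A : Set (ℕ → S) | ∃ x n, A = cyl x n} := by
  apply le_antisymm
  · refine iSup_le fun i => ?_
    rintro _ ⟨A, -, rfl⟩
    have : (fun ω : ℕ → S => ω i) ⁻¹' A =
        ⋃ x : {x : Fin (i + 1) → S // x (Fin.last i) ∈ A}, cyl (stopped x.1) i := by
      ext ω
      simp only [Set.mem_preimage, Set.mem_iUnion]
      constructor
      · intro h
        exact ⟨⟨fun j => ω j, by simpa using h⟩, mem_cyl_stopped ω i⟩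
      · rintro ⟨⟨x, hx⟩, h⟩
        rw [h i le_rfl]
        simpa [stopped, Fin.last] using hx
    change MeasurableSet[MeasurableSpace.generateFrom _] ((fun ω : ℕ → S => ω i) ⁻¹' A)
    rw [this]
    exact MeasurableSet.iUnion fun x => MeasurableSpace.measurableSet_generateFrom ⟨_, _, rfl⟩
  · refine MeasurableSpace.generateFrom_le ?_
    rintro _ ⟨x, n, rfl⟩
    exact measurableSet_cyl x n

lemma measure_ext_cyl [Finite S] {μ ρ : Measure (ℕ → S)} [IsFiniteMeasure μ]
    (huniv : μ Set.univ = ρ Set.univ) (h : ∀ x n, μ (cyl x n) = ρ (cyl x n)) : μ = ρ := by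
  refine ext_of_generate_finite _ generateFrom_cyl isPiSystem_cyl ?_ huniv
  rintro _ ⟨x, n, rfl⟩
  exact h x n

end Path

/-! ### The Markov property of the law of runs. -/

section Markov

variable {S : Type*} [MeasurableSpace S] [DiscreteMeasurableSpace S] (Δ : S → PMF S)

instance isProbabilityMeasure_runMeasure (s : S) : IsProbabilityMeasure (runMeasure Δ s) := by
  unfold runMeasure; infer_instance

/-- The kernel that sends a history of length `n + 1` to the law of the next state. -/
noncomputable abbrev historyKernel (n : ℕ) : Kernel ((i : Finset.Iic n) → S) S :=
  (stepKernel Δ).comap (fun h : (i : Finset.Iic n) → S => h ⟨n, Finset.mem_Iic.2 le_rfl⟩)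
    (measurable_pi_apply _)

lemma runMeasure_eq_traj (s : S) :
    runMeasure Δ s = Kernel.traj (X := fun _ : ℕ => S) (historyKernel Δ) 0
      ((MeasurableEquiv.piUnique (fun _ : Finset.Iic 0 => S)).symm s) := by
  have hd : (Measure.dirac s).map (MeasurableEquiv.piUnique (fun _ : Finset.Iic 0 => S)).symm =
      Measure.dirac ((MeasurableEquiv.piUnique (fun _ : Finset.Iic 0 => S)).symm s) :=
    Measure.map_dirac' (MeasurableEquiv.measurable _) _
  have hbind := congrArg (fun μ : Measure ((i : Finset.Iic 0) → S) =>
    μ.bind (Kernel.traj (X := fun _ : ℕ => S) (historyKernel Δ) 0)) hd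
  exact hbind.trans (Measure.dirac_bind (Kernel.measurable _) _)

lemma runMeasure_start (s : S) : runMeasure Δ s {ω | ω 0 = s} = 1 := by
  have key := Kernel.traj_map_frestrictLe_apply (X := fun _ : ℕ => S)
    (κ := historyKernel Δ) 0 0 ((MeasurableEquiv.piUnique (fun _ : Finset.Iic 0 => S)).symm s)
  rw [Kernel.partialTraj_self, Kernel.id_apply, ← runMeasure_eq_traj] at key
  have hm : MeasurableSet {y : Finset.Iic 0 → S | y ⟨0, by simp⟩ = s} :=
    show MeasurableSet ((fun y : Finset.Iic 0 → S => y ⟨0, by simp⟩) ⁻¹' {s}) from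
      measurable_pi_apply _ (measurableSet_singleton s)
  have h2 := congrArg (fun μ => μ {y : Finset.Iic 0 → S | y ⟨0, by simp⟩ = s}) key
  rw [Measure.map_apply (by fun_prop) hm, Measure.dirac_apply' _ hm] at h2
  refine Eq.trans h2 ?_
  rw [Set.indicator_of_mem]
  · rfl
  · rfl

lemma runMeasure_start_ne {s t : S} (h : t ≠ s) : runMeasure Δ s {ω | ω 0 = t} = 0 := by
  have h1 := (prob_compl_eq_zero_iff (measurableSet_apply_eq 0 s)).2 (runMeasure_start Δ s)
  refine measure_mono_null (fun ω hω => ?_) h1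
  exact fun h' => h (hω.symm.trans h')

lemma runMeasure_cyl_succ [Finite S] (s : S) (x : ℕ → S) (n : ℕ) :
    runMeasure Δ s (cyl x (n + 1)) = runMeasure Δ s (cyl x n) * Δ (x n) (x (n + 1)) := by
  have key := Kernel.map_frestrictLe_trajMeasure_compProd_eq_map_trajMeasure
    (X := fun _ : ℕ => S) (μ₀ := Measure.dirac s)
    (κ := historyKernel Δ) (a := n)
  change (runMeasure Δ s).map _ ⊗ₘ _ = (runMeasure Δ s).map _ at key
  -- The joint law of history and next state is evaluated at a single point.
  have h2 := congrArg (fun μ => μ ({Preorder.frestrictLe (π := fun _ : ℕ => S) n x} ×ˢ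
    {x (n + 1)})) key
  have hs : MeasurableSet ({Preorder.frestrictLe (π := fun _ : ℕ => S) n x} :
      Set ((i : Finset.Iic n) → S)) := measurableSet_singleton _
  have ht : MeasurableSet ({x (n + 1)} : Set S) := measurableSet_singleton _
  have hpre : (Preorder.frestrictLe (π := fun _ : ℕ => S) n) ⁻¹'
      {Preorder.frestrictLe (π := fun _ : ℕ => S) n x} = cyl x n := by
    ext ω
    simp only [Set.mem_preimage, Set.mem_singleton_iff, funext_iff, Subtype.forall,
      Finset.mem_Iic, Preorder.frestrictLe_apply, cyl, Set.mem_ofPred_eq]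
  have hpre2 : (fun ω : ℕ → S => (Preorder.frestrictLe (π := fun _ : ℕ => S) n ω, ω (n + 1))) ⁻¹'
      ({Preorder.frestrictLe (π := fun _ : ℕ => S) n x} ×ˢ {x (n + 1)}) = cyl x (n + 1) := by
    rw [Set.mk_preimage_prod, hpre]
    ext ω
    simp only [cyl, Set.mem_inter_iff, Set.mem_ofPred_eq, Set.mem_preimage, Set.mem_singleton_iff]
    exact ⟨fun h i hi => (Nat.le_succ_iff.1 hi).elim (h.1 i) fun e => e ▸ h.2,
      fun h => ⟨fun i hi => h i (by omega), h _ le_rfl⟩⟩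
  rw [Measure.compProd_apply_prod hs ht, Measure.map_apply (by fun_prop) (hs.prod ht)] at h2
  rw [hpre2] at h2
  rw [← h2, lintegral_singleton, Measure.map_apply (by fun_prop) hs, hpre, mul_comm]
  congr 1
  exact PMF.toMeasure_apply_singleton _ _ ht

variable [Fintype S]

lemma runMeasure_cyl_inter_suffix_cyl (s : S) (x y : ℕ → S) (n m : ℕ) :
    runMeasure Δ s (cyl x n ∩ (fun ω => suffix ω n) ⁻¹' cyl y m) =
      runMeasure Δ s (cyl x n) * runMeasure Δ (x n) (cyl y m) := by
  by_cases h : y 0 = x n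
  · induction m with
    | zero =>
      have h0 : cyl y 0 = {ω : ℕ → S | ω 0 = x n} := by
        ext ω; simp [cyl, h]
      rw [h0, runMeasure_start, mul_one]
      congr 1
      ext ω
      simp only [Set.mem_inter_iff, Set.mem_preimage, Set.mem_ofPred_eq, suffix, add_zero,
        and_iff_left_iff_imp]
      exact fun hω => hω n le_rfl
    | succ m ih =>
      rw [runMeasure_cyl_succ, ← mul_assoc, ← ih, cyl_inter_suffix _ _ _ _ h,
        cyl_inter_suffix _ _ _ _ h, ← add_assoc, runMeasure_cyl_succ]
      congr 2
      · rcases Nat.eq_zero_or_pos m with rfl | hm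
        · simp [h]
        · rw [if_neg (by omega), Nat.add_sub_cancel_left]
      · rw [if_neg (by omega), add_assoc, Nat.add_sub_cancel_left]
  · have h1 : runMeasure Δ (x n) (cyl y m) = 0 :=
      measure_mono_null (fun ω hω => hω 0 (Nat.zero_le _)) (runMeasure_start_ne Δ h)
    have h2 : cyl x n ∩ (fun ω => suffix ω n) ⁻¹' cyl y m = ∅ := by
      refine Set.eq_empty_of_forall_notMem fun ω hω => h ?_
      have a := hω.1 n le_rfl
      have b : ω (n + 0) = y 0 := hω.2 0 (Nat.zero_le _)
      rw [← b, ← a, add_zero]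
    rw [h1, h2, measure_empty, mul_zero]

/-- The Markov property at time `n`. -/
lemma runMeasure_cyl_inter_suffix (s : S) (x : ℕ → S) (n : ℕ) {A : Set (ℕ → S)}
    (hA : MeasurableSet A) :
    runMeasure Δ s (cyl x n ∩ (fun ω => suffix ω n) ⁻¹' A) =
      runMeasure Δ s (cyl x n) * runMeasure Δ (x n) A := by
  -- Both sides are measures in the event `A`, so agreement on cylinders suffices.
  have : ((runMeasure Δ s).restrict (cyl x n)).map (fun ω => suffix ω n) =
      runMeasure Δ s (cyl x n) • runMeasure Δ (x n) := by
    refine measure_ext_cyl ?_ fun y m => ?_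
    · rw [Measure.map_apply (measurable_suffix n) MeasurableSet.univ]
      simp
    · rw [Measure.map_apply (measurable_suffix n) (measurableSet_cyl y m),
        Measure.restrict_apply (measurable_suffix n (measurableSet_cyl y m)), Set.inter_comm,
        runMeasure_cyl_inter_suffix_cyl]
      rfl
  have h2 := congrArg (fun μ => μ A) this
  simpa [Measure.map_apply (measurable_suffix n) hA,
    Measure.restrict_apply (measurable_suffix n hA), Set.inter_comm] using h2

lemma runMeasure_suffix_null (s : S) (B : Finset S) (n : ℕ) {A : Set (ℕ → S)}
    (hA : MeasurableSet A) (h : ∀ t ∈ B, runMeasure Δ t A = 0) :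
    runMeasure Δ s {ω | ω n ∈ B ∧ suffix ω n ∈ A} = 0 := by
  refine measure_mono_null (t := ⋃ x : {x : Fin (n + 1) → S // x (Fin.last n) ∈ B},
    cyl (stopped x.1) n ∩ (fun ω => suffix ω n) ⁻¹' A) ?_ (measure_iUnion_null fun x => ?_)
  · rintro ω ⟨h1, h2⟩
    exact Set.mem_iUnion.2 ⟨⟨fun j => ω j, by simpa using h1⟩, mem_cyl_stopped ω n, h2⟩
  · rw [runMeasure_cyl_inter_suffix Δ s _ n hA, h, mul_zero]
    simpa [stopped, Fin.last] using x.2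

/-- First-step decomposition: the length-two prefixes `s, t` split almost every run from `s`. -/
lemma runMeasure_suffix_one (s : S) {A : Set (ℕ → S)} (hA : MeasurableSet A) :
    runMeasure Δ s ((fun ω => suffix ω 1) ⁻¹' A) = ∑ t, Δ s t * runMeasure Δ t A := by
  classical
  let x : S → ℕ → S := fun t i => if i = 0 then s else t
  have hcyl : ∀ t, cyl (x t) 1 = {ω | ω 0 = s} ∩ {ω | ω 1 = t} := by
    intro t
    ext ω
    simp only [cyl, Set.mem_ofPred_eq, Set.mem_inter_iff, x]
    constructor
    · intro h
      exact ⟨by simpa using h 0 (by simp), by simpa using h 1 le_rfl⟩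
    · rintro ⟨h0, h1⟩ i hi
      interval_cases i <;> simp [h0, h1]
  have hone : ∀ t, runMeasure Δ s (cyl (x t) 1) = Δ s t := by
    intro t
    have h0 : cyl (x t) 0 = {ω | ω 0 = s} := by ext ω; simp [cyl, x]
    rw [runMeasure_cyl_succ, h0, runMeasure_start, one_mul]
    simp [x]
  have hsum : ∀ t, Δ s t * runMeasure Δ t A =
      runMeasure Δ s (cyl (x t) 1 ∩ (fun ω => suffix ω 1) ⁻¹' A) := by
    intro t
    rw [runMeasure_cyl_inter_suffix Δ s (x t) 1 hA, hone]
    simp [x]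
  simp_rw [hsum]
  rw [← measure_biUnion_finset]
  · refine measure_congr ?_
    have h1 := (prob_compl_eq_zero_iff (measurableSet_apply_eq 0 s)).2 (runMeasure_start Δ s)
    have h2 : ∀ᵐ ω ∂runMeasure Δ s, ω 0 = s := h1
    filter_upwards [h2] with ω hω
    refine propext ?_
    change suffix ω 1 ∈ A ↔ ω ∈ ⋃ t ∈ Finset.univ, _
    simp [hcyl, hω]
  · intro t _ u _ htu
    refine Set.disjoint_left.2 fun ω h1 h2 => htu ?_
    have h1 := (hcyl t ▸ h1.1).2
    have h2 := (hcyl u ▸ h2.1).2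
    exact h1.symm.trans h2
  · exact fun t _ => (measurableSet_cyl _ _).inter (measurable_suffix 1 hA)

end Markov

/-! ### Runs with a random initial state. -/

section Mixture

variable {S : Type*} [MeasurableSpace S] [DiscreteMeasurableSpace S]

/-- The law of the runs whose initial state is distributed on `B` according to `w`. -/
noncomputable def mixture (Δ : S → PMF S) (B : Finset S) (w : S → ℝ≥0) : Measure (ℕ → S) :=
  ∑ t ∈ B, w t • runMeasure Δ t

lemma mixture_apply (Δ : S → PMF S) (B : Finset S) (w : S → ℝ≥0) (A : Set (ℕ → S)) :
    mixture Δ B w A = ∑ t ∈ B, w t * runMeasure Δ t A := by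
  rw [mixture, Measure.finsetSum_apply]
  rfl

lemma integral_mixture (Δ : S → PMF S) (B : Finset S) (w : S → ℝ≥0) {f : (ℕ → S) → ℝ}
    (hf : ∀ s, Integrable f (runMeasure Δ s)) :
    ∫ ω, f ω ∂mixture Δ B w = ∑ t ∈ B, w t * ∫ ω, f ω ∂runMeasure Δ t := by
  rw [mixture, integral_finsetSum_measure fun t _ => (hf t).smul_measure_nnreal]
  refine Finset.sum_congr rfl fun t _ => ?_
  rw [integral_smul_nnreal_measure]
  rfl

end Mixture

/-! ### Stationary distributions and the zero-one law on a bscc. -/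

section BSCC

variable {S : Type*} {Δ : S → PMF S} {B : Finset S}

lemma IsBSCC.mem_of_step (hB : IsBSCC Δ B) {s t : S} (hs : s ∈ B) (h : Δ s t ≠ 0) : t ∈ B := by
  have : t ∈ {t | Reachable Δ s t} := Relation.ReflTransGen.single (pos_iff_ne_zero.2 h)
  rw [hB.2 s hs] at this
  exact this

lemma IsBSCC.reachable (hB : IsBSCC Δ B) {s t : S} (hs : s ∈ B) (ht : t ∈ B) :
    Reachable Δ s t := by
  have : t ∈ (B : Set S) := ht
  rw [← hB.2 s hs] at this
  exact this

variable [Fintype S]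

lemma sum_toReal_eq_one (Δ : S → PMF S) (s : S) : ∑ t, (Δ s t).toReal = 1 := by
  rw [← ENNReal.toReal_sum fun t _ => (Δ s).apply_ne_top t, ← tsum_fintype (L := .unconditional S),
    (Δ s).tsum_coe, ENNReal.toReal_one]

lemma IsBSCC.sum_toReal_eq_one (hB : IsBSCC Δ B) {s : S} (hs : s ∈ B) :
    ∑ t ∈ B, (Δ s t).toReal = 1 := by
  rw [← FreqLTL.sum_toReal_eq_one Δ s]
  refine Finset.sum_subset (Finset.subset_univ _) fun t _ ht => ?_
  by_contra h
  exact ht (hB.mem_of_step hs fun h0 => h (by rw [h0, ENNReal.toReal_zero]))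

/-- The maximum principle: harmonic functions are constant on a bottom component. -/
lemma IsBSCC.eq_of_harmonic (hB : IsBSCC Δ B) (u : S → ℝ)
    (hu : ∀ s ∈ B, u s = ∑ t ∈ B, (Δ s t).toReal * u t) {s t : S} (hs : s ∈ B) (ht : t ∈ B) :
    u s = u t := by
  obtain ⟨m, hm, hmax⟩ := B.exists_max_image u hB.1
  have step : ∀ a ∈ B, u a = u m → ∀ b, 0 < Δ a b → u b = u m := by
    intro a ha hau b hab
    have hb : b ∈ B := hB.mem_of_step ha hab.ne'
    -- An average of values at most `u m` equals `u m` only if every value of positive weight does.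
    have h0 : ∑ c ∈ B, (Δ a c).toReal * (u m - u c) = 0 := by
      simp_rw [mul_sub]
      rw [Finset.sum_sub_distrib, ← Finset.sum_mul, hB.sum_toReal_eq_one ha, ← hu a ha, hau]
      ring
    have h1 := (Finset.sum_eq_zero_iff_of_nonneg fun c hc =>
      mul_nonneg ENNReal.toReal_nonneg (sub_nonneg.2 (hmax c hc))).1 h0 b hb
    have h2 := (ENNReal.toReal_pos hab.ne' ((Δ a).apply_ne_top b)).ne'
    linarith [(mul_eq_zero.1 h1).resolve_left h2]
  have all : ∀ a, Reachable Δ m a → a ∈ B ∧ u a = u m := by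
    intro a h
    induction h with
    | refl => exact ⟨hm, rfl⟩
    | tail _ hbc ih => exact ⟨hB.mem_of_step ih.1 hbc.ne', step _ ih.1 ih.2 _ hbc⟩
  rw [(all s (hB.reachable hm hs)).2, (all t (hB.reachable hm ht)).2]

/-- The transition matrix on `B` fixes the constant vector on the right, hence some `v ≠ 0` on the
left. The triangle inequality gives `|v| ≤ |v| M` entrywise; rows sum to one, so both sides have
equal totals and equality holds. Thus `|v|` is stationary. -/
lemma IsBSCC.exists_stationary_real (hB : IsBSCC Δ B) :
    ∃ w : S → ℝ, (∀ t, 0 ≤ w t) ∧ 0 < ∑ t ∈ B, w t ∧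
      ∀ t ∈ B, ∑ s ∈ B, w s * (Δ s t).toReal = w t := by
  classical
  let M : Matrix B B ℝ := fun s t => (Δ s t).toReal
  have hrow : ∀ s : B, ∑ t : B, M s t = 1 := fun s => by
    rw [← hB.sum_toReal_eq_one s.2]
    exact Finset.sum_coe_sort B fun t => (Δ s t).toReal
  have hdet : (1 - M).det = 0 := by
    rw [← Matrix.exists_mulVec_eq_zero_iff]
    refine ⟨fun _ => 1, ?_, ?_⟩
    · intro h
      obtain ⟨b, hb⟩ := hB.1
      exact one_ne_zero (congrFun h ⟨b, hb⟩)
    · ext s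
      have h1 : (1 - M).mulVec (fun _ => 1) s = 1 - ∑ t, M s t := by
        rw [Matrix.sub_mulVec, Matrix.one_mulVec]
        simp [Matrix.mulVec, dotProduct]
      rw [h1, hrow, sub_self, Pi.zero_apply]
  obtain ⟨v, hv0, hv⟩ := Matrix.exists_vecMul_eq_zero_iff.2 hdet
  have hvt : ∀ t, v t = ∑ s, v s * M s t := fun t => by
    have := congrFun hv t
    simp only [Matrix.vecMul_sub, Matrix.vecMul_one, Pi.sub_apply, Pi.zero_apply] at this
    exact sub_eq_zero.1 this
  have hM : ∀ s t, 0 ≤ M s t := fun s t => ENNReal.toReal_nonneg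
  have hle : ∀ t, |v t| ≤ ∑ s, |v s| * M s t := fun t => by
    conv_lhs => rw [hvt t]
    refine (Finset.abs_sum_le_sum_abs _ _).trans (Finset.sum_le_sum fun s _ => ?_)
    rw [abs_mul, abs_of_nonneg (hM s t)]
  have hsum : ∑ t, |v t| = ∑ t, ∑ s, |v s| * M s t := by
    rw [Finset.sum_comm]
    simp_rw [← Finset.mul_sum, hrow, mul_one]
  have heq := (Finset.sum_eq_sum_iff_of_le fun t _ => hle t).1 hsum
  refine ⟨fun s => if h : s ∈ B then |v ⟨s, h⟩| else 0, fun t => ?_, ?_, fun t ht => ?_⟩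
  · dsimp only
    split_ifs <;> positivity
  · rw [← Finset.sum_coe_sort B]
    obtain ⟨b, hb⟩ := Function.ne_iff.1 hv0
    refine Finset.sum_pos' (fun i _ => by simp) ⟨b, Finset.mem_univ _, ?_⟩
    simpa using hb
  · rw [← Finset.sum_coe_sort B]
    simp only [Finset.coe_mem, dite_true, ht, Subtype.coe_eta]
    exact (heq ⟨t, ht⟩ (Finset.mem_univ _)).symm

/-- A bottom component carries a stationary distribution. -/
lemma IsBSCC.exists_stationary (hB : IsBSCC Δ B) :
    ∃ w : S → ℝ≥0, ∑ t ∈ B, w t = 1 ∧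
      ∀ t ∈ B, ∑ s ∈ B, (w s : ℝ≥0∞) * Δ s t = w t := by
  obtain ⟨w, hw0, hpos, hw⟩ := hB.exists_stationary_real
  have hdiv : ∀ t, ((w t / ∑ s ∈ B, w s).toNNReal : ℝ) = w t / ∑ s ∈ B, w s := fun t =>
    Real.coe_toNNReal _ (div_nonneg (hw0 t) hpos.le)
  refine ⟨fun t => (w t / ∑ s ∈ B, w s).toNNReal, ?_, fun t ht => ?_⟩
  · apply NNReal.coe_injective
    rw [NNReal.coe_sum, Finset.sum_congr rfl fun t _ => hdiv t, ← Finset.sum_div,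
      div_self hpos.ne', NNReal.coe_one]
  · have hfin : ∀ s ∈ B, ((w s / ∑ s ∈ B, w s).toNNReal : ℝ≥0∞) * Δ s t ≠ ⊤ := fun s _ =>
      ENNReal.mul_ne_top ENNReal.coe_ne_top ((Δ s).apply_ne_top t)
    rw [← ENNReal.toReal_eq_toReal_iff' (ENNReal.sum_ne_top.2 hfin) ENNReal.coe_ne_top,
      ENNReal.toReal_sum hfin]
    simp only [ENNReal.toReal_mul, ENNReal.coe_toReal, hdiv]
    rw [← hw t ht, Finset.sum_div]
    exact Finset.sum_congr rfl fun s _ => by ring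

variable [MeasurableSpace S] [DiscreteMeasurableSpace S]

lemma IsBSCC.mem_of_runMeasure_cyl_ne_zero (hB : IsBSCC Δ B) {s : S} (hs : s ∈ B) (x : ℕ → S)
    (n : ℕ) (h : runMeasure Δ s (cyl x n) ≠ 0) : x n ∈ B := by
  induction n with
  | zero =>
    by_contra hx
    refine h (measure_mono_null (fun ω hω => hω 0 le_rfl) (runMeasure_start_ne Δ (t := x 0) ?_))
    rintro rfl
    exact hx hs
  | succ n ih =>
    rw [runMeasure_cyl_succ] at h
    exact hB.mem_of_step (ih (left_ne_zero_of_mul h)) (right_ne_zero_of_mul h)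

/-- Shift-invariant events are trivial on a bottom component. -/
lemma IsBSCC.zero_one (hB : IsBSCC Δ B) {A : Set (ℕ → S)} (hA : MeasurableSet A)
    (hinv : ∀ ω, suffix ω 1 ∈ A ↔ ω ∈ A) :
    (∀ s ∈ B, runMeasure Δ s A = 0) ∨ ∀ s ∈ B, runMeasure Δ s A = 1 := by
  have hinvn : ∀ n ω, suffix ω n ∈ A ↔ ω ∈ A := by
    intro n
    induction n with
    | zero => intro ω; rw [suffix_zero]
    | succ n ih => intro ω; rw [← suffix_suffix, hinv, ih]
  -- By invariance of `A` and the first-step decomposition, the probability of `A` is harmonic in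
  -- the starting state.
  have hconst : ∀ s ∈ B, ∀ t ∈ B, runMeasure Δ s A = runMeasure Δ t A := by
    intro s hs t ht
    rw [← ENNReal.toReal_eq_toReal_iff' (measure_ne_top _ _) (measure_ne_top _ _)]
    refine hB.eq_of_harmonic (fun s => (runMeasure Δ s A).toReal) (fun s hs => ?_) hs ht
    have h1 := runMeasure_suffix_one Δ s hA
    have h2 : (fun ω : ℕ → S => suffix ω 1) ⁻¹' A = A := by ext ω; exact hinv ω
    rw [h2] at h1
    rw [h1, ENNReal.toReal_sum fun t _ =>
      ENNReal.mul_ne_top ((Δ s).apply_ne_top t) (measure_ne_top _ _)]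
    simp_rw [ENNReal.toReal_mul]
    refine (Finset.sum_subset (Finset.subset_univ _) fun t _ ht => ?_).symm
    have h0 : Δ s t = 0 := by
      by_contra h
      exact ht (hB.mem_of_step hs h)
    rw [h0, ENNReal.toReal_zero, zero_mul]
  obtain ⟨b, hb⟩ := hB.1
  -- Given any prefix of positive probability, `A` keeps the same probability, so it is independent
  -- of all events; testing against its complement forces probability 0 or 1.
  have hrestr : (runMeasure Δ b).restrict A = runMeasure Δ b A • runMeasure Δ b := by
    refine measure_ext_cyl (by simp) fun x n => ?_
    have h1 : cyl x n ∩ A = cyl x n ∩ (fun ω => suffix ω n) ⁻¹' A := by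
      ext ω
      exact and_congr_right fun _ => (hinvn n ω).symm
    rw [Measure.restrict_apply (measurableSet_cyl x n), h1, runMeasure_cyl_inter_suffix Δ b x n hA,
      Measure.smul_apply, smul_eq_mul]
    by_cases h0 : runMeasure Δ b (cyl x n) = 0
    · rw [h0, zero_mul, mul_zero]
    · rw [hconst (x n) (hB.mem_of_runMeasure_cyl_ne_zero hb x n h0) b hb, mul_comm]
  have hcompl := congrArg (fun μ => μ Aᶜ) hrestr
  simp only [Measure.restrict_apply hA.compl, Set.compl_inter_self, measure_empty,
    Measure.smul_apply, smul_eq_mul] at hcompl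
  rcases mul_eq_zero.1 hcompl.symm with h | h
  · exact Or.inl fun s hs => (hconst s hs b hb).trans h
  · exact Or.inr fun s hs => (hconst s hs b hb).trans ((prob_compl_eq_zero_iff hA).1 h)

/-- After one step the initial state is again distributed according to `w`. -/
lemma IsBSCC.measurePreserving_mixture (hB : IsBSCC Δ B) {w : S → ℝ≥0}
    (hw : ∀ t ∈ B, ∑ s ∈ B, (w s : ℝ≥0∞) * Δ s t = w t) :
    MeasurePreserving (fun ω => suffix ω 1) (mixture Δ B w) (mixture Δ B w) := by
  refine ⟨measurable_suffix 1, Measure.ext fun A hA => ?_⟩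
  rw [Measure.map_apply (measurable_suffix 1) hA, mixture_apply, mixture_apply]
  have h1 : ∀ s ∈ B, (w s : ℝ≥0∞) * runMeasure Δ s ((fun ω => suffix ω 1) ⁻¹' A) =
      ∑ t ∈ B, w s * Δ s t * runMeasure Δ t A := by
    intro s hs
    rw [runMeasure_suffix_one Δ s hA, Finset.mul_sum]
    simp_rw [← mul_assoc]
    refine (Finset.sum_subset (Finset.subset_univ _) fun t _ ht => ?_).symm
    have h0 : Δ s t = 0 := by
      by_contra h
      exact ht (hB.mem_of_step hs h)
    rw [h0, mul_zero, zero_mul]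
  rw [Finset.sum_congr rfl h1, Finset.sum_comm]
  refine Finset.sum_congr rfl fun t ht => ?_
  rw [← Finset.sum_mul, hw t ht]

end BSCC

/-! ### Almost sure convergence of time averages. -/

section Averages

variable {S : Type*}

lemma birkhoffAverage_suffix (f : (ℕ → S) → ℝ) (n : ℕ) (ω : ℕ → S) :
    birkhoffAverage ℝ (fun ω => suffix ω 1) f n ω =
      (1 / (n : ℝ)) * ∑ j ∈ Finset.range n, f (suffix ω j) := by
  simp only [birkhoffAverage, birkhoffSum, iterate_suffix_one, smul_eq_mul, one_div]

/-- The set of runs along which the upper limit of the averages of `f` is at most `a`. -/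
def averagesLimsupLe (f : (ℕ → S) → ℝ) (a : ℝ) : Set (ℕ → S) :=
  {ω | ∀ k : ℕ, ∃ N, ∀ n ≥ N, birkhoffAverage ℝ (fun ω => suffix ω 1) f n ω ≤ a + 1 / (k + 1)}

lemma tendsto_birkhoffAverage_suffix_one_sub {f : (ℕ → S) → ℝ} {C : ℝ} (hC : ∀ ω, |f ω| ≤ C)
    (ω : ℕ → S) :
    Tendsto (fun n => birkhoffAverage ℝ (fun ω => suffix ω 1) f n (suffix ω 1) -
      birkhoffAverage ℝ (fun ω => suffix ω 1) f n ω) atTop (𝓝 0) :=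
  tendsto_birkhoffAverage_apply_sub_birkhoffAverage' ℝ
    (isBounded_iff_forall_norm_le.2 ⟨C, by rintro _ ⟨η, rfl⟩; exact hC η⟩) (fun ω => suffix ω 1) ω

lemma mem_averagesLimsupLe_of_tendsto_sub {f : (ℕ → S) → ℝ} {a : ℝ} {ω η : ℕ → S}
    (h : Tendsto (fun n => birkhoffAverage ℝ (fun ω => suffix ω 1) f n η -
      birkhoffAverage ℝ (fun ω => suffix ω 1) f n ω) atTop (𝓝 0))
    (hω : ω ∈ averagesLimsupLe f a) : η ∈ averagesLimsupLe f a := by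
  intro k
  -- This index halves the slack `1 / (k + 1)`; the other half absorbs the difference of the
  -- averages.
  obtain ⟨N, hN⟩ := hω (2 * k + 1)
  have hpos : (0 : ℝ) < 1 / (2 * (k + 1)) := by positivity
  obtain ⟨N', hN'⟩ := eventually_atTop.1 (h.eventually (gt_mem_nhds hpos))
  refine ⟨max N N', fun n hn => ?_⟩
  have h1 := hN n (le_of_max_le_left hn)
  have h2 := hN' n (le_of_max_le_right hn)
  have h3 : (1 : ℝ) / ((2 * k + 1 : ℕ) + 1) + 1 / (2 * (k + 1)) = 1 / (k + 1) := by
    push_cast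
    field_simp
    ring
  linarith

lemma suffix_one_mem_averagesLimsupLe_iff {f : (ℕ → S) → ℝ} {C : ℝ} (hC : ∀ ω, |f ω| ≤ C) (a : ℝ)
    (ω : ℕ → S) : suffix ω 1 ∈ averagesLimsupLe f a ↔ ω ∈ averagesLimsupLe f a := by
  have h := tendsto_birkhoffAverage_suffix_one_sub hC ω
  refine ⟨mem_averagesLimsupLe_of_tendsto_sub ?_, mem_averagesLimsupLe_of_tendsto_sub h⟩
  simpa using h.neg

lemma tendsto_birkhoffAverage_of_suffix {f : (ℕ → S) → ℝ} {C : ℝ} (hC : ∀ ω, |f ω| ≤ C)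
    {c : ℝ} (n : ℕ) (ω : ℕ → S)
    (h : Tendsto (birkhoffAverage ℝ (fun ω => suffix ω 1) f · (suffix ω n)) atTop (𝓝 c)) :
    Tendsto (birkhoffAverage ℝ (fun ω => suffix ω 1) f · ω) atTop (𝓝 c) := by
  induction n with
  | zero => rwa [suffix_zero] at h
  | succ n ih =>
    rw [← suffix_suffix] at h
    refine ih ?_
    simpa using h.sub (tendsto_birkhoffAverage_suffix_one_sub hC (suffix ω n))

variable [MeasurableSpace S]

lemma measurable_birkhoffAverage_suffix {f : (ℕ → S) → ℝ} (hf : Measurable f) (n : ℕ) :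
    Measurable (birkhoffAverage ℝ (fun ω => suffix ω 1) f n) := by
  have : birkhoffAverage ℝ (fun ω => suffix ω 1) f n =
      fun ω => (1 / (n : ℝ)) * ∑ j ∈ Finset.range n, f (suffix ω j) :=
    funext (birkhoffAverage_suffix f n)
  rw [this]
  exact measurable_const.mul (Finset.measurable_fun_sum _ fun j _ => hf.comp (measurable_suffix j))

lemma measurableSet_averagesLimsupLe {f : (ℕ → S) → ℝ} (hf : Measurable f) (a : ℝ) :
    MeasurableSet (averagesLimsupLe f a) := by
  have : averagesLimsupLe f a = ⋂ k : ℕ, ⋃ N : ℕ, ⋂ n : ℕ, ⋂ (_ : n ≥ N),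
      {ω | birkhoffAverage ℝ (fun ω => suffix ω 1) f n ω ≤ a + 1 / (k + 1)} := by
    ext ω
    simp only [averagesLimsupLe, Set.mem_ofPred_eq, Set.mem_iInter, Set.mem_iUnion]
  rw [this]
  exact MeasurableSet.iInter fun k => MeasurableSet.iUnion fun N => MeasurableSet.iInter fun n =>
    MeasurableSet.iInter fun _ =>
      measurableSet_le (measurable_birkhoffAverage_suffix hf n) measurable_const

variable [DiscreteMeasurableSpace S] {Δ : S → PMF S} {B : Finset S}

lemma integrable_runMeasure {f : (ℕ → S) → ℝ} (hf : Measurable f) {C : ℝ}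
    (hC : ∀ ω, |f ω| ≤ C) (s : S) : Integrable f (runMeasure Δ s) :=
  Integrable.of_bound hf.aestronglyMeasurable C (ae_of_all _ hC)

variable [Fintype S]

/-- By the zero-one law the alternative is that almost every run has some average of `f` above `a`,
hence a positive Birkhoff sum of `f - a`. The maximal ergodic theorem would then make the mean of
`f` at least `a`. -/
lemma IsBSCC.ae_mem_averagesLimsupLe (hB : IsBSCC Δ B) {w : S → ℝ≥0} (hsum : ∑ t ∈ B, w t = 1)
    (hw : ∀ t ∈ B, ∑ s ∈ B, (w s : ℝ≥0∞) * Δ s t = w t) {f : (ℕ → S) → ℝ} (hf : Measurable f)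
    {C : ℝ} (hC : ∀ ω, |f ω| ≤ C) {a : ℝ} (ha : ∑ t ∈ B, w t * ∫ ω, f ω ∂runMeasure Δ t < a)
    {s : S} (hs : s ∈ B) : ∀ᵐ ω ∂runMeasure Δ s, ω ∈ averagesLimsupLe f a := by
  have hA := measurableSet_averagesLimsupLe hf a
  rcases hB.zero_one hA (suffix_one_mem_averagesLimsupLe_iff hC a) with h0 | h1
  · exfalso
    have hnull : ∀ᵐ ω ∂mixture Δ B w, ω ∉ averagesLimsupLe f a := by
      refine (ae_iff.2 ?_)
      simp only [not_not]
      change mixture Δ B w (averagesLimsupLe f a) = 0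
      rw [mixture_apply]
      exact Finset.sum_eq_zero fun t ht => by rw [h0 t ht, mul_zero]
    have hi : ∀ t, Integrable (fun ω => f ω - a) (runMeasure Δ t) := fun t =>
      (integrable_runMeasure hf hC t).sub (integrable_const a)
    have hint : ∫ ω, (f ω - a) ∂mixture Δ B w =
        (∑ t ∈ B, w t * ∫ ω, f ω ∂runMeasure Δ t) - a := by
      rw [integral_mixture Δ B w hi]
      have h2 : ∀ t ∈ B, (w t : ℝ) * ∫ ω, (f ω - a) ∂runMeasure Δ t =
          w t * (∫ ω, f ω ∂runMeasure Δ t) - w t * a := fun t _ => by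
        rw [integral_sub (integrable_runMeasure hf hC t) (integrable_const a), mul_sub]
        simp
      rw [Finset.sum_congr rfl h2, Finset.sum_sub_distrib, ← Finset.sum_mul, ← NNReal.coe_sum,
        hsum, NNReal.coe_one, one_mul]
    have himix : Integrable (fun ω => f ω - a) (mixture Δ B w) :=
      integrable_finsetSum_measure.2 fun t _ => (hi t).smul_measure_nnreal
    have hmax := integral_nonneg_of_ae_exists_birkhoffSum_pos
      (g := fun ω => f ω - a) (hB.measurePreserving_mixture hw)
      (hf.sub measurable_const) himix ?_
    · rw [hint] at hmax
      linarith
    · filter_upwards [hnull] with ω hω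
      simp only [averagesLimsupLe, Set.mem_ofPred_eq, not_forall, not_exists, not_le] at hω
      obtain ⟨k, hk⟩ := hω
      -- Starting at 1 ensures `n > 0`, so that the average can be multiplied by `n`.
      obtain ⟨n, hn, hlt⟩ := hk 1
      refine ⟨n, ?_⟩
      have hn0 : (0 : ℝ) < n := by exact_mod_cast hn
      have hk0 : (0 : ℝ) < 1 / (k + 1) := by positivity
      have hlt' : a < (n : ℝ)⁻¹ * birkhoffSum (fun ω => suffix ω 1) f n ω := by
        have := (lt_add_of_pos_right a hk0).trans hlt
        simpa [birkhoffAverage] using this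
      have hexp : birkhoffSum (fun ω => suffix ω 1) (fun ω => f ω - a) n ω =
          birkhoffSum (fun ω => suffix ω 1) f n ω - n * a := by
        simp [birkhoffSum, Finset.sum_sub_distrib]
      have := (lt_inv_mul_iff₀ hn0).1 hlt'
      change 0 < birkhoffSum (fun ω => suffix ω 1) (fun ω => f ω - a) n ω
      rw [hexp]
      linarith
  · exact (mem_ae_iff_prob_eq_one hA).2 (h1 s hs)

/-- The ergodic theorem for runs started in a bottom component with stationary distribution `w`. -/
theorem IsBSCC.ae_tendsto_birkhoffAverage (hB : IsBSCC Δ B) {w : S → ℝ≥0}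
    (hsum : ∑ t ∈ B, w t = 1) (hw : ∀ t ∈ B, ∑ s ∈ B, (w s : ℝ≥0∞) * Δ s t = w t)
    {f : (ℕ → S) → ℝ} (hf : Measurable f) {C : ℝ} (hC : ∀ ω, |f ω| ≤ C) {s : S} (hs : s ∈ B) :
    ∀ᵐ ω ∂runMeasure Δ s, Tendsto (birkhoffAverage ℝ (fun ω => suffix ω 1) f · ω) atTop
      (𝓝 (∑ t ∈ B, w t * ∫ ω, f ω ∂runMeasure Δ t)) := by
  set c := ∑ t ∈ B, w t * ∫ ω, f ω ∂runMeasure Δ t with hc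
  have hneg : ∑ t ∈ B, w t * ∫ ω, (-f) ω ∂runMeasure Δ t = -c := by
    simp [hc, integral_neg]
  have hup : ∀ᵐ ω ∂runMeasure Δ s, ∀ k : ℕ, ω ∈ averagesLimsupLe f (c + 1 / (k + 1)) :=
    ae_all_iff.2 fun k => hB.ae_mem_averagesLimsupLe hsum hw hf hC
      (lt_add_of_pos_right _ (by positivity)) hs
  -- The lower bound is the upper bound for `-f`.
  have hlo : ∀ᵐ ω ∂runMeasure Δ s, ∀ k : ℕ, ω ∈ averagesLimsupLe (-f) (-c + 1 / (k + 1)) :=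
    ae_all_iff.2 fun k => hB.ae_mem_averagesLimsupLe hsum hw hf.neg
      (C := C) (fun ω => by simpa using hC ω)
      (hneg.trans_lt (lt_add_of_pos_right _ (by positivity))) hs
  filter_upwards [hup, hlo] with ω h1 h2
  rw [Metric.tendsto_atTop]
  intro ε hε
  -- The error `1 / (k + 1)` enters twice: in the level above the mean and in the slack of
  -- `averagesLimsupLe`.
  obtain ⟨k, hk⟩ := exists_nat_one_div_lt (half_pos hε)
  obtain ⟨N1, hN1⟩ := h1 k k
  obtain ⟨N2, hN2⟩ := h2 k k
  refine ⟨max N1 N2, fun n hn => ?_⟩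
  have a1 := hN1 n (le_of_max_le_left hn)
  have a2 := hN2 n (le_of_max_le_right hn)
  rw [birkhoffAverage_neg] at a2
  simp only [Pi.neg_apply] at a2
  rw [Real.dist_eq, abs_lt]
  constructor <;> linarith

/-- Almost every run that enters a bottom component has the ergodic averages of the component. -/
theorem IsBSCC.ae_tendsto_birkhoffAverage_of_enters (hB : IsBSCC Δ B) {w : S → ℝ≥0}
    (hsum : ∑ t ∈ B, w t = 1) (hw : ∀ t ∈ B, ∑ s ∈ B, (w s : ℝ≥0∞) * Δ s t = w t)
    {f : (ℕ → S) → ℝ} (hf : Measurable f) {C : ℝ} (hC : ∀ ω, |f ω| ≤ C) (s : S) :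
    ∀ᵐ ω ∂runMeasure Δ s, (∃ n, ω n ∈ B) →
      Tendsto (birkhoffAverage ℝ (fun ω => suffix ω 1) f · ω) atTop
        (𝓝 (∑ t ∈ B, w t * ∫ ω, f ω ∂runMeasure Δ t)) := by
  set c := ∑ t ∈ B, w t * ∫ ω, f ω ∂runMeasure Δ t
  have hA : MeasurableSet
      {ω | Tendsto (birkhoffAverage ℝ (fun ω => suffix ω 1) f · ω) atTop (𝓝 c)} :=
    measurableSet_tendsto (𝓝 c) fun n => measurable_birkhoffAverage_suffix hf n
  -- A countable union over all times spent in `B` replaces a stopping-time argument.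
  have hn : ∀ᵐ ω ∂runMeasure Δ s, ∀ n, ¬ (ω n ∈ B ∧ suffix ω n ∈
      {ω | Tendsto (birkhoffAverage ℝ (fun ω => suffix ω 1) f · ω) atTop (𝓝 c)}ᶜ) := by
    refine ae_all_iff.2 fun n => ?_
    rw [ae_iff]
    simp only [not_not]
    exact runMeasure_suffix_null Δ s B n hA.compl fun t ht =>
      hB.ae_tendsto_birkhoffAverage hsum hw hf hC ht
  filter_upwards [hn] with ω hω
  rintro ⟨n, hnB⟩
  have := not_and_not_right.1 (hω n) hnB
  exact tendsto_birkhoffAverage_of_suffix hC n ω this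

end Averages

/-! ### Frequencies of formulae and of states. -/

section Frequencies

variable {S : Type*}

lemma freq_eq_of_tendsto {A : Set (ℕ → S)} {ω : ℕ → S} {c : ℝ}
    (h : Tendsto (birkhoffAverage ℝ (fun ω => suffix ω 1) (A.indicator 1) · ω) atTop (𝓝 c)) :
    freq (Set.indicator {i : ℕ | suffix ω i ∈ A} 1) = c := by
  refine Tendsto.liminf_eq (h.congr fun n => ?_)
  rw [birkhoffAverage_suffix]
  rfl

lemma abs_indicator_one_le (A : Set (ℕ → S)) (ω : ℕ → S) :
    |A.indicator (1 : (ℕ → S) → ℝ) ω| ≤ 1 := by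
  by_cases h : ω ∈ A <;> simp [h]

variable [MeasurableSpace S] [DiscreteMeasurableSpace S]

lemma measurableSet_sat {AP : Type*} (ν : S → Set AP) (φ : Formula AP) (hφ : φ.IsLTL) :
    MeasurableSet {ω : ℕ → S | Sat ν φ ω} := by
  induction φ with
  | atom a =>
    exact measurable_pi_apply (X := fun _ : ℕ => S) 0
      (MeasurableSet.of_discrete (s := {s | a ∈ ν s}))
  | neg φ ih => exact (ih hφ).compl
  | or φ ψ ih₁ ih₂ => exact (ih₁ hφ.1).union (ih₂ hφ.2)
  | next φ ih => exact measurable_suffix 1 (ih hφ)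
  | untl φ ψ ih₁ ih₂ =>
    have : {ω : ℕ → S | Sat ν (φ.untl ψ) ω} = ⋃ k : ℕ, (fun ω => suffix ω k) ⁻¹' {ω | Sat ν ψ ω} ∩
        ⋂ l : ℕ, ⋂ (_ : l < k), (fun ω => suffix ω l) ⁻¹' {ω | Sat ν φ ω} := by
      ext ω
      simp [Sat]
    rw [this]
    exact MeasurableSet.iUnion fun k => (measurable_suffix k (ih₂ hφ.2)).inter
      (MeasurableSet.iInter fun l => MeasurableSet.iInter fun _ => measurable_suffix l (ih₁ hφ.1))
  | freqG p φ _ => exact hφ.elim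

variable [Fintype S] {Δ : S → PMF S} {B : Finset S}

/-- For the indicator of starting in `t`, only runs from `t` contribute to the limit, which is
therefore `w t`; the frequency is almost surely this constant. -/
lemma IsBSCC.steadyFreq_eq (hB : IsBSCC Δ B) {w : S → ℝ≥0} (hsum : ∑ t ∈ B, w t = 1)
    (hw : ∀ t ∈ B, ∑ s ∈ B, (w s : ℝ≥0∞) * Δ s t = w t) {t : S} (ht : t ∈ B) :
    steadyFreq Δ t = w t := by
  have hA : MeasurableSet {ω : ℕ → S | ω 0 = t} := measurableSet_apply_eq 0 t
  have hlim := hB.ae_tendsto_birkhoffAverage hsum hw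
    (measurable_one.indicator hA) (abs_indicator_one_le _) ht
  have hc : ∑ u ∈ B, (w u : ℝ) * ∫ ω, Set.indicator {ω : ℕ → S | ω 0 = t} 1 ω ∂runMeasure Δ u =
      w t := by
    rw [Finset.sum_eq_single_of_mem t ht]
    · rw [integral_indicator_one hA, measureReal_def, runMeasure_start]
      simp
    · intro u _ hut
      rw [integral_indicator_one hA, measureReal_def, runMeasure_start_ne Δ hut.symm]
      simp
  rw [hc] at hlim
  have hfreq : ∀ᵐ ω ∂runMeasure Δ t,
      freq (Set.indicator {i : ℕ | ω i = t} 1) = w t := by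
    filter_upwards [hlim] with ω hω
    have h := freq_eq_of_tendsto (A := {ω : ℕ → S | ω 0 = t}) hω
    have hset : {i : ℕ | suffix ω i ∈ {ω : ℕ → S | ω 0 = t}} = {i : ℕ | ω i = t} := by
      ext i
      simp [suffix]
    rwa [hset] at h
  rw [steadyFreq, integral_congr_ae hfreq]
  simp

end Frequencies

end FreqLTL

theorem mainTheorem2 {S AP : Type*} [Fintype S] [MeasurableSpace S] [DiscreteMeasurableSpace S]
    (Δ : S → PMF S) (ν : S → Set AP) (s_in : S)
    (φ : FreqLTL.Formula AP) (hφ : φ.IsLTL) (p : ℝ)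
    (B : Finset S) (hB : FreqLTL.IsBSCC Δ B) :
    ∀ᵐ ω ∂(FreqLTL.runMeasure Δ s_in), (∃ n, ω n ∈ B) →
      (FreqLTL.Sat ν (FreqLTL.Formula.freqG p φ) ω ↔
        p ≤ ∑ t ∈ B, FreqLTL.steadyFreq Δ t * FreqLTL.satProb Δ ν t φ) := by
  obtain ⟨w, hsum, hw⟩ := hB.exists_stationary
  have hA := FreqLTL.measurableSet_sat ν φ hφ
  have hc : ∑ t ∈ B, FreqLTL.steadyFreq Δ t * FreqLTL.satProb Δ ν t φ =
      ∑ t ∈ B, (w t : ℝ) *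
        ∫ ω, Set.indicator {ω | FreqLTL.Sat ν φ ω} 1 ω ∂FreqLTL.runMeasure Δ t :=
    Finset.sum_congr rfl fun t ht => by
      rw [hB.steadyFreq_eq hsum hw ht, integral_indicator_one hA, FreqLTL.satProb]
  filter_upwards [hB.ae_tendsto_birkhoffAverage_of_enters hsum hw (measurable_one.indicator hA)
    (FreqLTL.abs_indicator_one_le _) s_in] with ω hω hn
  have hfreq := FreqLTL.freq_eq_of_tendsto (hω hn)
  rw [hc, ← hfreq]
  rfl
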